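/- Let $A\in\mathbb{R}^{n\times n}$ be symmetric positive definite with spectrum contained in $W=[\lambda_1,\lambda_n]$, where $0<\lambda_1<\lambda_n$ (for instance the smallest and largest eigenvalues of $A$, when these differ). Put $c=(\lambda_n+\lambda_1)/2$, $r=(\lambda_n-\lambda_1)/2$. Let $\Psi(w)=c+\frac r2\left(w+\frac1w\right)$ be the conformal map of $\{|w|>1\}$ onto $\mathbb{C}\setminus W$ that fixes $\infty$ and has positive derivative there, and let $\Phi=\Psi^{-1}:\mathbb{C}\setminus W\to\{|w|>1\}$. Define $$B(w)=w\,\frac{1-\overline{\Phi(0)}\,w}{\Phi(0)-w},$$ the Takenaka–Malmquist functions, for $\ell=0,1,2,\dots$, $$\phi_{2\ell}(w)=B(w)^\ell,\qquad \phi_{2\ell+1}(w)=-\frac{\sqrt{1-|\Phi(0)|^{-2}}}{1-\Phi(0)^{-1}w}\,w\,B(w)^\ell ,$$ and, for any fixed $R$ with $1<R<|\Phi(0)|$, their Faber–Dzhrbashyan transforms $$M_k(u)=\frac1{2\pi i}\int_{\Gamma_R}\frac{\phi_k(\Phi(\xi))}{\xi-u}\,d\xi ,\qquad u\in G_R,\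 k=0,1,2,\dots,$$ where $\Gamma_R=\{\xi\in\mathbb{C}\setminus W:|\Phi(\xi)|=R\}$, positively oriented, and $G_R=W\cup\{\xi\in\mathbb{C}\setminus W:|\Phi(\xi)|<R\}$. With $A=U\,\mathrm{diag}(\mu_1,\dots,\mu_n)\,U^T$, $U$ real orthogonal, let $M_k(A)=U\,\mathrm{diag}(M_k(\mu_1),\dots,M_k(\mu_n))\,U^T$. Then for every $z\in\mathbb{C}\setminus W$ the matrix $zI-A$ is invertible, $\Phi(z)\Psi'(\Phi(z))\neq0$, the series below converges absolutely, and $$(zI-A)^{-1}=\frac1{\Phi(z)\,\Psi'(\Phi(z))}\sum_{k=0}^\infty \phi_k\!\left(\Phi(z)^{-1}\right)M_k(A).$$ -/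

import Mathlib

open Filter Topology

/-- `1 < ‖w‖`: the exterior of the closed unit disk (without the point at infinity). -/
def extDisk : Set ℂ := {w | 1 < ‖w‖}

/-- The real interval `[a, b]` as a subset of the complex plane. -/
def realSegment (a b : ℝ) : Set ℂ := (fun t : ℝ => (t : ℂ)) '' Set.Icc a b

/-- `Ψ` maps the exterior of the closed unit disk conformally onto the complement of `K`, fixes the
point at infinity and has a positive derivative there. -/
structure IsExteriorRiemannMap (K : Set ℂ) (Ψ : ℂ → ℂ) : Prop where
  holomorphic : DifferentiableOn ℂ Ψ extDisk
  bijOn : Set.BijOn Ψ extDisk Kᶜ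
  map_infty : Tendsto Ψ (Bornology.cobounded ℂ) (Bornology.cobounded ℂ)
  deriv_infty : ∃ d : ℝ, 0 < d ∧ Tendsto (fun w => Ψ w / w) (Bornology.cobounded ℂ) (𝓝 (d : ℂ))

/-- The exterior Riemann map of `[a, b]`: `Ψ(w) = c + (r / 2) (w + 1 / w)` with
`c = (b + a) / 2` and `r = (b - a) / 2`. -/
noncomputable def extPsi (a b : ℝ) (w : ℂ) : ℂ :=
  (((b + a) / 2 : ℝ) : ℂ) + (((b - a) / 2 : ℝ) : ℂ) / 2 * (w + 1 / w)

/-- `Φ = Ψ⁻¹`, from the complement of `[a, b]` to the exterior of the unit disk. -/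
noncomputable def extPhi (a b : ℝ) : ℂ → ℂ := Function.invFunOn (extPsi a b) extDisk

theorem extPsi_bijOn {a b : ℝ} (hab : a < b) :
    Set.BijOn (extPsi a b) extDisk (realSegment a b)ᶜ := by
  have hr : (((b - a) / 2 : ℝ) : ℂ) ≠ 0 := by
    exact_mod_cast (by linarith : (0 : ℝ) < (b - a) / 2).ne'
  have hne : ∀ w ∈ extDisk, w ≠ 0 := by
    rintro w hw rfl
    simp [extDisk] at hw
    linarith
  refine ⟨?_, ?_, ?_⟩
  · rintro w hw ⟨t, ⟨ht1, ht2⟩, hwt⟩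
    have hw0 := hne w hw
    have hr' : 0 < (b - a) / 2 := by linarith
    obtain ⟨x, hx⟩ : ∃ x : ℝ, t = (b + a) / 2 + (b - a) / 2 * x :=
      ⟨(t - (b + a) / 2) / ((b - a) / 2), by rw [mul_div_cancel₀ _ hr'.ne']; ring⟩
    have hx1 : x ≤ 1 := by nlinarith
    have hx2 : -1 ≤ x := by nlinarith
    have key : w ^ 2 - 2 * x * w + 1 = 0 := by
      have h1 : (((b - a) / 2 : ℝ) : ℂ) * (2 * x - (w + 1 / w)) = 0 := by
        have h2 : (t : ℂ) = extPsi a b w := hwt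
        rw [hx, extPsi] at h2
        push_cast at h2 ⊢
        linear_combination 2 * h2
      have h3 := (mul_eq_zero.mp h1).resolve_left hr
      field_simp at h3
      linear_combination -h3
    have hre := congrArg Complex.re key
    have him := congrArg Complex.im key
    simp [pow_two] at hre him
    have hw1 : 1 < w.re * w.re + w.im * w.im := by
      have h : 1 < ‖w‖ := hw
      have h2 := Complex.normSq_eq_norm_sq w
      rw [Complex.normSq_apply] at h2
      rw [h2]
      nlinarith
    have h4 : w.im * (w.re - x) = 0 := by linarith
    rcases mul_eq_zero.mp h4 with h | h
    · rw [h] at hre hw1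
      have : w.re = x := by nlinarith [sq_nonneg (w.re - x)]
      nlinarith
    · have : w.re = x := by linarith
      rw [this] at hre hw1
      nlinarith
  · intro w hw v hv h
    have hw0 := hne w hw
    have hv0 := hne v hv
    have h1 : (((b - a) / 2 : ℝ) : ℂ) * ((w + 1 / w) - (v + 1 / v)) = 0 := by
      simp only [extPsi] at h
      linear_combination 2 * h
    have h3 := (mul_eq_zero.mp h1).resolve_left hr
    have h4 : (w - v) * (w * v - 1) = 0 := by
      field_simp at h3
      linear_combination h3
    rcases mul_eq_zero.mp h4 with h5 | h5
    · exact sub_eq_zero.mp h5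
    · exfalso
      have h6 : ‖w‖ * ‖v‖ = 1 := by
        rw [← norm_mul, sub_eq_zero.mp h5, norm_one]
      have hw' : 1 < ‖w‖ := hw
      have hv' : 1 < ‖v‖ := hv
      nlinarith
  · intro z hz
    set u : ℂ := (z - (((b + a) / 2 : ℝ) : ℂ)) / (((b - a) / 2 : ℝ) : ℂ) with hu
    have hzu : z = (((b + a) / 2 : ℝ) : ℂ) + (((b - a) / 2 : ℝ) : ℂ) * u := by
      rw [hu]
      field_simp
      ring
    obtain ⟨s, hs⟩ := IsAlgClosed.exists_pow_nat_eq (u ^ 2 - 1) (by norm_num : 0 < 2)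
    have hprod : (u + s) * (u - s) = 1 := by linear_combination -hs
    have hp0 : u + s ≠ 0 := fun h => by simp [h] at hprod
    have hm0 : u - s ≠ 0 := fun h => by simp [h] at hprod
    have hpi : 1 / (u + s) = u - s := by
      rw [div_eq_iff hp0]
      linear_combination -hprod
    have hmi : 1 / (u - s) = u + s := by
      rw [div_eq_iff hm0]
      linear_combination -hprod
    have hn : ‖u + s‖ * ‖u - s‖ = 1 := by rw [← norm_mul, hprod, norm_one]
    rcases lt_trichotomy ‖u + s‖ 1 with h | h | h
    · refine ⟨u - s, ?_, ?_⟩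
      · change 1 < ‖u - s‖
        by_contra hcon
        nlinarith [norm_nonneg (u - s), norm_nonneg (u + s)]
      · rw [extPsi, hmi, hzu]
        ring
    · exfalso
      apply hz
      have hconj : u - s = (starRingEnd ℂ) (u + s) := by
        have h7 : (u + s) * (starRingEnd ℂ) (u + s) = 1 := by
          rw [Complex.mul_conj, Complex.normSq_eq_norm_sq, h]
          simp
        exact mul_left_cancel₀ hp0 (hprod.trans h7.symm)
      have hure : u = ((u + s).re : ℂ) := by
        rw [Complex.re_eq_add_conj, ← hconj]
        ring
      have habs := Complex.abs_re_le_norm (u + s)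
      rw [h, abs_le] at habs
      refine ⟨(b + a) / 2 + (b - a) / 2 * (u + s).re, ⟨?_, ?_⟩, ?_⟩
      · nlinarith [habs.1]
      · nlinarith [habs.2]
      · change (((b + a) / 2 + (b - a) / 2 * (u + s).re : ℝ) : ℂ) = z
        rw [hzu]
        conv_rhs => rw [hure]
        push_cast
        ring
    · refine ⟨u + s, h, ?_⟩
      rw [extPsi, hpi, hzu]
      ring

theorem extPsi_isExteriorRiemannMap {a b : ℝ} (hab : a < b) :
    IsExteriorRiemannMap (realSegment a b) (extPsi a b) := by
  have hr : 0 < (b - a) / 2 / 2 := by linarith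
  have hinv : Tendsto (fun w : ℂ => w⁻¹) (Bornology.cobounded ℂ) (𝓝 0) :=
    tendsto_inv₀_cobounded
  have hne : ∀ᶠ w : ℂ in Bornology.cobounded ℂ, w ≠ 0 := by
    filter_upwards [(tendsto_norm_cobounded_atTop (E := ℂ)).eventually_gt_atTop 0] with w hw
    exact norm_pos_iff.mp hw
  have hder : Tendsto (fun w => extPsi a b w / w) (Bornology.cobounded ℂ)
      (𝓝 (((b - a) / 2 / 2 : ℝ) : ℂ)) := by
    have h : Tendsto (fun w : ℂ => (((b + a) / 2 : ℝ) : ℂ) * w⁻¹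
        + (((b - a) / 2 : ℝ) : ℂ) / 2 * (1 + w⁻¹ * w⁻¹)) (Bornology.cobounded ℂ)
        (𝓝 ((((b + a) / 2 : ℝ) : ℂ) * 0 + (((b - a) / 2 : ℝ) : ℂ) / 2 * (1 + 0 * 0))) :=
      (hinv.const_mul _).add (((hinv.mul hinv).const_add 1).const_mul _)
    have he : (((b + a) / 2 : ℝ) : ℂ) * 0 + (((b - a) / 2 : ℝ) : ℂ) / 2 * (1 + 0 * 0)
        = (((b - a) / 2 / 2 : ℝ) : ℂ) := by
      push_cast
      ring
    rw [he] at h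
    refine h.congr' ?_
    filter_upwards [hne] with w hw
    rw [extPsi]
    field_simp
  refine ⟨?_, extPsi_bijOn hab, ?_, (b - a) / 2 / 2, hr, hder⟩
  · intro w hw
    have hw0 : w ≠ 0 := by
      rintro rfl
      simp [extDisk] at hw
      linarith
    apply DifferentiableAt.differentiableWithinAt
    unfold extPsi
    fun_prop (disch := exact hw0)
  · rw [← tendsto_norm_atTop_iff_cobounded]
    have h1 := hder.norm
    have h2 : 0 < ‖(((b - a) / 2 / 2 : ℝ) : ℂ)‖ := by
      rw [Complex.norm_real, Real.norm_of_nonneg hr.le]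
      exact hr
    refine (h1.pos_mul_atTop h2 (tendsto_norm_cobounded_atTop (E := ℂ))).congr' ?_
    filter_upwards [hne] with w hw
    rw [← norm_mul, div_mul_cancel₀ _ hw]

theorem extPhi_invOn {a b : ℝ} (hab : a < b) :
    Set.InvOn (extPhi a b) (extPsi a b) extDisk (realSegment a b)ᶜ :=
  (extPsi_bijOn hab).invOn_invFunOn

/-- The level curve `Γ_R = {z ∉ [a, b] : |Φ(z)| = R}`. -/
def levelCurve (a b R : ℝ) : Set ℂ := {z | z ∉ realSegment a b ∧ ‖extPhi a b z‖ = R}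

/-- The positively oriented parametrization `θ ↦ Ψ(R e^{iθ})`, `0 ≤ θ ≤ 2π`, of `Γ_R`. -/
noncomputable def levelParam (a b R : ℝ) (θ : ℝ) : ℂ := extPsi a b (circleMap 0 R θ)

theorem levelParam_image {a b R : ℝ} (hab : a < b) (hR : 1 < R) :
    levelParam a b R '' Set.Icc 0 (2 * Real.pi) = levelCurve a b R := by
  have hR0 : 0 ≤ R := by linarith
  have hmem : ∀ θ, circleMap 0 R θ ∈ extDisk := fun θ => by
    change 1 < ‖circleMap 0 R θ‖
    rw [norm_circleMap_zero, abs_of_nonneg hR0]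
    exact hR
  ext z
  constructor
  · rintro ⟨θ, -, rfl⟩
    refine ⟨(extPsi_bijOn hab).mapsTo (hmem θ), ?_⟩
    rw [levelParam, (extPhi_invOn hab).1 (hmem θ), norm_circleMap_zero, abs_of_nonneg hR0]
  · rintro ⟨hz, hn⟩
    have h1 : extPhi a b z ∈ Metric.sphere (0 : ℂ) R := by simpa using hn
    rw [← abs_of_nonneg hR0, ← image_circleMap_Ioc] at h1
    obtain ⟨θ, hθ, h2⟩ := h1
    refine ⟨θ, Set.Ioc_subset_Icc_self hθ, ?_⟩
    rw [levelParam, h2]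
    exact (extPhi_invOn hab).2 hz

/-- The contour integral `∫_{Γ_R} f(ξ) dξ`. -/
noncomputable def levelIntegral (a b R : ℝ) (f : ℂ → ℂ) : ℂ :=
  ∫ θ in (0 : ℝ)..(2 * Real.pi), deriv (levelParam a b R) θ * f (levelParam a b R θ)

/-- The Blaschke product `B(w) = w (1 - conj(p) w) / (p - w)`; it is used with `p = Φ(0)`. -/
noncomputable def blaschkeB (p w : ℂ) : ℂ := w * ((1 - (starRingEnd ℂ) p * w) / (p - w))

/-- The Takenaka-Malmquist functions: `φ_{2l} = B ^ l` and
`φ_{2l+1}(w) = -√(1 - |p|⁻²) / (1 - p⁻¹ w) * w * B(w) ^ l`; used with `p = Φ(0)`. -/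
noncomputable def tmPhi (p : ℂ) (k : ℕ) (w : ℂ) : ℂ :=
  if Even k then blaschkeB p w ^ (k / 2)
  else -((Real.sqrt (1 - (‖p‖ ^ 2)⁻¹) : ℂ) / (1 - p⁻¹ * w)) * w * blaschkeB p w ^ (k / 2)

/-- The Faber-Dzhrbashyan function
`M_k(z) = (1 / (2πi)) ∫_{Γ_R} φ_k(Φ(ξ)) / (ξ - z) dξ`, for `z` enclosed by `Γ_R`. -/
noncomputable def faberM (a b R : ℝ) (k : ℕ) (z : ℂ) : ℂ :=
  (2 * Real.pi * Complex.I)⁻¹ *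
    levelIntegral a b R (fun ξ => tmPhi (extPhi a b 0) k (extPhi a b ξ) / (ξ - z))

/-- The function `f(A) = U diag(f(λ₁), …, f(λₙ)) Uᴴ` of a real symmetric matrix
`A = U diag(λ₁, …, λₙ) Uᵀ`, with `U` real orthogonal. -/
noncomputable def symmMatrixFunction {n : ℕ} {A : Matrix (Fin n) (Fin n) ℝ} (hA : A.IsHermitian)
    (f : ℂ → ℂ) : Matrix (Fin n) (Fin n) ℂ :=
  (hA.eigenvectorUnitary : Matrix (Fin n) (Fin n) ℝ).map (fun t : ℝ => (t : ℂ)) *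
    Matrix.diagonal (fun i => f (hA.eigenvalues i : ℂ)) *
    ((hA.eigenvectorUnitary : Matrix (Fin n) (Fin n) ℝ).map (fun t : ℝ => (t : ℂ))).conjTranspose

/-! Write ζ = Φ(z), p = Φ(0), and u = Ψ(e) with |e| = 1 for u in the interval. Everything rests on
the partial fractions Ψ'(w)/(Ψ(w) - Ψ(e)) = 1/(w - e) + 1/(w - 1/e) - 1/w, used twice. In the
contour integral, the substitution ξ = Ψ(w) and Cauchy's formula turn them into M_k(u) = φ_k(e) +
φ_k(1/e) - φ_k(0) (`faberM_extPsi`). Since p is real, the reproducing kernel gives ∑ φ_k(v) φ_k(w) =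
1/(1 - vw) without conjugates (`hasSum_tmPhi_mul_tmPhi`). Taking v = 1/ζ and w = e, 1/e, 0, the same
partial fractions at w = ζ reassemble the three kernels into ζ Ψ'(ζ)/(z - u). The matrix statement
is this scalar identity at each eigenvalue. -/

/-! ### The exterior map and its boundary values -/

/-- The derivative of the exterior map `extPsi a b` away from `0`. -/
theorem hasDerivAt_extPsi (a b : ℝ) {w : ℂ} (hw : w ≠ 0) :
    HasDerivAt (extPsi a b) ((((b - a) / 2 : ℝ) : ℂ) / 2 * (1 - 1 / w ^ 2)) w := by
  have h := (((hasDerivAt_id w).add (hasDerivAt_inv hw)).const_mul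
    ((((b - a) / 2 : ℝ) : ℂ) / 2)).const_add (((b + a) / 2 : ℝ) : ℂ)
  refine (h.congr_of_eventuallyEq (Eventually.of_forall fun x => ?_)).congr_deriv ?_
  · simp [extPsi]
  · simp only [one_div]
    ring

/-- Every point of `[a, b]` is the image under `extPsi a b` of a point of the unit circle. -/
theorem exists_norm_eq_one_extPsi_eq {a b : ℝ} (hab : a < b) {u : ℝ} (hu : u ∈ Set.Icc a b) :
    ∃ e : ℂ, ‖e‖ = 1 ∧ extPsi a b e = u := by
  have hr : 0 < (b - a) / 2 := by linarith
  set x : ℝ := (u - (b + a) / 2) / ((b - a) / 2) with hx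
  have hx1 : -1 ≤ x := by
    rw [hx, le_div_iff₀ hr]
    linarith [hu.1]
  have hx2 : x ≤ 1 := by
    rw [hx, div_le_iff₀ hr]
    linarith [hu.2]
  have hux : u = (b + a) / 2 + (b - a) / 2 * x := by
    rw [hx, mul_div_cancel₀ _ hr.ne']
    ring
  -- On the unit circle Ψ(e^{iθ}) = c + r cos θ, so θ = arccos x works.
  refine ⟨Complex.exp (Real.arccos x * Complex.I), Complex.norm_exp_ofReal_mul_I _, ?_⟩
  have hcos : (x : ℂ) = Complex.cos (Real.arccos x) := by
    rw [← Complex.ofReal_cos, Real.cos_arccos hx1 hx2]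
  rw [extPsi, one_div, ← Complex.exp_neg, hux]
  push_cast
  rw [hcos, Complex.cos]
  simp only [neg_mul]
  ring

/-- Factorization of `extPsi a b w - extPsi a b e`. -/
theorem extPsi_sub_extPsi (a b : ℝ) {w e : ℂ} (hw : w ≠ 0) (he : e ≠ 0) :
    extPsi a b w - extPsi a b e =
      (((b - a) / 2 : ℝ) : ℂ) / 2 * ((w - e) * (w - e⁻¹) / w) := by
  simp only [extPsi]
  field_simp
  ring

/-- Partial fractions of the logarithmic derivative of `extPsi a b - extPsi a b e`. -/
theorem deriv_extPsi_div_sub {a b : ℝ} (hab : a < b) {w e : ℂ} (hw : 1 < ‖w‖) (he : ‖e‖ = 1) :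
    deriv (extPsi a b) w / (extPsi a b w - extPsi a b e) =
      (w - e)⁻¹ + (w - e⁻¹)⁻¹ - (w - 0)⁻¹ := by
  have hr : (((b - a) / 2 : ℝ) : ℂ) ≠ 0 := by
    exact_mod_cast (by linarith : (0 : ℝ) < (b - a) / 2).ne'
  have hw0 : w ≠ 0 := norm_pos_iff.mp (by linarith)
  have he0 : e ≠ 0 := norm_pos_iff.mp (by linarith)
  have h1 : w - e ≠ 0 := sub_ne_zero.mpr fun h => by rw [h, he] at hw; exact lt_irrefl _ hw
  have h2 : w - e⁻¹ ≠ 0 := sub_ne_zero.mpr fun h => by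
    rw [h, norm_inv, he, inv_one] at hw; exact lt_irrefl _ hw
  rw [(hasDerivAt_extPsi a b hw0).deriv, extPsi_sub_extPsi a b hw0 he0, sub_zero,
    mul_div_mul_left _ _ (div_ne_zero hr two_ne_zero), inv_add_inv h1 h2,
    ← one_div w, div_sub_div _ _ (mul_ne_zero h1 h2) hw0, div_div_eq_mul_div,
    div_eq_div_iff (mul_ne_zero h1 h2) (mul_ne_zero (mul_ne_zero h1 h2) hw0)]
  field_simp
  ring

/-- The base point `extPhi a b 0` is real. -/
theorem conj_extPhi_zero {a b : ℝ} (ha : 0 < a) (hab : a < b) :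
    (starRingEnd ℂ) (extPhi a b 0) = extPhi a b 0 := by
  have h0 : (0 : ℂ) ∈ (realSegment a b)ᶜ := by
    rintro ⟨t, ht, h⟩
    have : t = 0 := Complex.ofReal_eq_zero.mp h
    linarith [ht.1]
  have hm : extPhi a b 0 ∈ extDisk := (extPsi_bijOn hab).surjOn.mapsTo_invFunOn h0
  have hp : extPsi a b (extPhi a b 0) = 0 := (extPhi_invOn hab).2 h0
  -- Ψ has real coefficients, so conj p is a second zero of Ψ in the exterior disk; injectivity
  -- identifies it with p.
  refine (extPsi_bijOn hab).injOn ?_ hm ?_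
  · change 1 < ‖_‖
    rw [Complex.norm_conj]
    exact hm
  · have h := congrArg (starRingEnd ℂ) hp
    rw [hp]
    simpa [extPsi, map_ofNat] using h

/-! ### Takenaka–Malmquist functions and their kernel -/

/-- The Takenaka-Malmquist functions are holomorphic off the pole `p`. -/
theorem differentiableAt_tmPhi {p : ℂ} (hp : p ≠ 0) (k : ℕ) {w : ℂ} (hw : w ≠ p) :
    DifferentiableAt ℂ (tmPhi p k) w := by
  have h1 : p - w ≠ 0 := sub_ne_zero.mpr hw.symm
  have h2 : 1 - p⁻¹ * w ≠ 0 := by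
    intro h
    apply h1
    have h3 : p * (1 - p⁻¹ * w) = p - w := by field_simp
    rw [← h3, h, mul_zero]
  have hB : DifferentiableAt ℂ (blaschkeB p) w := by
    unfold blaschkeB
    fun_prop (disch := assumption)
  unfold tmPhi
  by_cases hk : Even k
  · simp only [hk, if_true]
    fun_prop
  · simp only [hk, if_false]
    fun_prop (disch := assumption)

/-- The Blaschke product is bounded by `1` on the closed unit disk. -/
theorem norm_blaschkeB_le {p w : ℂ} (hp : 1 < ‖p‖) (hw : ‖w‖ ≤ 1) : ‖blaschkeB p w‖ ≤ ‖w‖ := by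
  have h1 : p - w ≠ 0 := sub_ne_zero.mpr fun h => by rw [h] at hp; linarith
  have h2 : ‖1 - (starRingEnd ℂ) p * w‖ ≤ ‖p - w‖ := by
    rw [← sq_le_sq₀ (norm_nonneg _) (norm_nonneg _)]
    have hw2 : ‖w‖ ^ 2 ≤ 1 := pow_le_one₀ (norm_nonneg _) hw
    have hp2 : 1 ≤ ‖p‖ ^ 2 := one_le_pow₀ hp.le
    rw [← Complex.normSq_eq_norm_sq, Complex.normSq_apply] at hw2 hp2 ⊢
    rw [← Complex.normSq_eq_norm_sq, Complex.normSq_apply]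
    simp only [Complex.sub_re, Complex.sub_im, Complex.mul_re, Complex.mul_im, Complex.one_re,
      Complex.one_im, Complex.conj_re, Complex.conj_im]
    -- |p - w|² - |1 - conj(p) w|² = (1 - |w|²)(|p|² - 1).
    nlinarith [mul_nonneg (sub_nonneg.mpr hw2) (sub_nonneg.mpr hp2)]
  rw [blaschkeB, norm_mul, norm_div]
  exact mul_le_of_le_one_right (norm_nonneg _) (div_le_one_of_le₀ h2 (norm_nonneg _))

/-- Products of Takenaka-Malmquist functions of even index. -/
theorem tmPhi_even_mul (p v w : ℂ) (l : ℕ) :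
    tmPhi p (2 * l) v * tmPhi p (2 * l) w = (blaschkeB p v * blaschkeB p w) ^ l := by
  simp [tmPhi, mul_pow]

/-- Products of Takenaka-Malmquist functions of odd index, for a real parameter. -/
theorem tmPhi_odd_mul {p : ℂ} (hp : 1 < ‖p‖) (hreal : (starRingEnd ℂ) p = p) {v w : ℂ}
    (hpv : p - v ≠ 0) (hpw : p - w ≠ 0) (l : ℕ) :
    tmPhi p (2 * l + 1) v * tmPhi p (2 * l + 1) w =
      (p ^ 2 - 1) * (v * w) / ((p - v) * (p - w)) * (blaschkeB p v * blaschkeB p w) ^ l := by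
  have hp0 : p ≠ 0 := norm_pos_iff.mp (by linarith)
  have hp2 : (‖p‖ : ℂ) ^ 2 = p ^ 2 := by
    rw [← Complex.mul_conj', hreal, sq]
  have hs : (Real.sqrt (1 - (‖p‖ ^ 2)⁻¹) : ℂ) * (Real.sqrt (1 - (‖p‖ ^ 2)⁻¹) : ℂ) * p ^ 2 =
      p ^ 2 - 1 := by
    rw [← Complex.ofReal_mul, Real.mul_self_sqrt
      (sub_nonneg.mpr (inv_le_one_of_one_le₀ (one_le_pow₀ hp.le)))]
    push_cast
    rw [hp2, sub_mul, one_mul, inv_mul_cancel₀ (pow_ne_zero 2 hp0)]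
  have hfac : ∀ x : ℂ, 1 - p⁻¹ * x = (p - x) / p := fun x => by field_simp
  have hodd : ¬ Even (2 * l + 1) := by simp
  have hdiv : (2 * l + 1) / 2 = l := by omega
  simp only [tmPhi, if_neg hodd, hdiv, hfac, mul_pow, ← hs, div_div_eq_mul_div]
  generalize (Real.sqrt (1 - (‖p‖ ^ 2)⁻¹) : ℂ) = s
  generalize blaschkeB p v ^ l = x
  generalize blaschkeB p w ^ l = y
  field_simp

/-- The two-term Christoffel-Darboux identity. -/
theorem one_sub_blaschkeB_mul {p v w : ℂ} (hreal : (starRingEnd ℂ) p = p)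
    (hpv : p - v ≠ 0) (hpw : p - w ≠ 0) :
    1 - blaschkeB p v * blaschkeB p w =
      (1 - v * w) * (1 + (p ^ 2 - 1) * (v * w) / ((p - v) * (p - w))) := by
  rw [blaschkeB, blaschkeB, hreal]
  field_simp
  ring

/-- The reproducing kernel expansion of the Takenaka-Malmquist functions with real parameter:
`∑ φ_k(v) φ_k(w) = 1 / (1 - v w)`. -/
theorem hasSum_tmPhi_mul_tmPhi {p : ℂ} (hp : 1 < ‖p‖) (hreal : (starRingEnd ℂ) p = p) {v w : ℂ}
    (hv : ‖v‖ < 1) (hw : ‖w‖ ≤ 1) :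
    HasSum (fun k => tmPhi p k v * tmPhi p k w) (1 - v * w)⁻¹ := by
  have hpv : p - v ≠ 0 := sub_ne_zero.mpr fun h => by rw [h] at hp; linarith
  have hpw : p - w ≠ 0 := sub_ne_zero.mpr fun h => by rw [h] at hp; linarith
  -- Strictness comes from v alone, so w may lie on the unit circle.
  have hq : ‖blaschkeB p v * blaschkeB p w‖ < 1 := by
    rw [norm_mul]
    have h1 := norm_blaschkeB_le hp hv.le
    have h2 := norm_blaschkeB_le hp hw
    exact mul_lt_one_of_nonneg_of_lt_one_left (norm_nonneg _) (h1.trans_lt hv) (h2.trans hw)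
  have hq1 : 1 - blaschkeB p v * blaschkeB p w ≠ 0 := by
    refine sub_ne_zero.mpr fun h => ?_
    rw [← h, norm_one] at hq
    exact lt_irrefl _ hq
  have hgeo := hasSum_geometric_of_norm_lt_one hq
  -- Each pair of indices 2l, 2l + 1 contributes a fixed factor times (B(v)B(w))^l, so both halves
  -- are geometric series.
  have hsum := (hgeo.congr_fun fun l => tmPhi_even_mul p v w l).even_add_odd
    (f := fun k => tmPhi p k v * tmPhi p k w)
    ((hgeo.mul_left _).congr_fun fun l => tmPhi_odd_mul hp hreal hpv hpw l)
  have hcd := one_sub_blaschkeB_mul hreal hpv hpw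
  rw [← one_add_mul] at hsum
  have hval : (1 - v * w)⁻¹ = (1 + (p ^ 2 - 1) * (v * w) / ((p - v) * (p - w))) *
      (1 - blaschkeB p v * blaschkeB p w)⁻¹ := by
    -- By the Christoffel–Darboux factorization, 1 - B(v)B(w) ≠ 0 makes the pair factor nonzero, so
    -- it cancels.
    rw [hcd] at hq1 ⊢
    rw [mul_inv, mul_left_comm, mul_inv_cancel₀ (right_ne_zero_of_mul hq1), mul_one]
  rw [hval]
  exact hsum

/-! ### Faber–Dzhrbashyan functions and the scalar expansion -/

/-- The Faber-Dzhrbashyan functions in closed form on the segment. -/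
theorem faberM_extPsi {a b R : ℝ} (hab : a < b) (hR : 1 < R) (hRΦ : R < ‖extPhi a b 0‖) (k : ℕ)
    {e : ℂ} (he : ‖e‖ = 1) :
    faberM a b R k (extPsi a b e) = tmPhi (extPhi a b 0) k e + tmPhi (extPhi a b 0) k e⁻¹ -
      tmPhi (extPhi a b 0) k 0 := by
  set p := extPhi a b 0
  have hp0 : p ≠ 0 := norm_pos_iff.mp (by linarith)
  have hR0 : 0 < R := by linarith
  have hnorm : ∀ θ, ‖circleMap 0 R θ‖ = R := fun θ => by
    rw [norm_circleMap_zero, abs_of_pos hR0]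
  -- The only possible pole is p, outside the closed disk because R < |p|.
  have hdiff : DifferentiableOn ℂ (tmPhi p k) (Metric.closedBall 0 R) := fun w hw => by
    refine (differentiableAt_tmPhi hp0 k fun h => ?_).differentiableWithinAt
    rw [mem_closedBall_zero_iff, h] at hw
    linarith
  have hcauchy : ∀ x : ℂ, ‖x‖ < R → (∮ w in C(0, R), (w - x)⁻¹ • tmPhi p k w) =
      (2 * Real.pi * Complex.I : ℂ) • tmPhi p k x := fun x hx =>
    (hdiff.diffContOnCl_ball subset_rfl).circleIntegral_sub_inv_smul (by simpa using hx)
  have hint : ∀ x : ℂ, ‖x‖ < R →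
      CircleIntegrable (fun w => (w - x)⁻¹ • tmPhi p k w) 0 R := fun x hx => by
    refine ContinuousOn.circleIntegrable hR0.le ?_
    refine ContinuousOn.smul (ContinuousOn.inv₀ (continuousOn_id.sub continuousOn_const) fun w hw h => ?_)
      (hdiff.continuousOn.mono Metric.sphere_subset_closedBall)
    rw [mem_sphere_zero_iff_norm, show w = x from sub_eq_zero.mp h] at hw
    linarith
  have he1 : ‖e‖ < R := he ▸ hR
  have he2 : ‖e⁻¹‖ < R := by rwa [norm_inv, he, inv_one]
  have h0 : ‖(0 : ℂ)‖ < R := by simpa using hR0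
  -- Substituting ξ = Ψ(w) moves the integral to |w| = R, where e, 1/e and 0 all lie inside.
  have hlevel : levelIntegral a b R (fun ξ => tmPhi p k (extPhi a b ξ) / (ξ - extPsi a b e)) =
      ∮ w in C(0, R), ((w - e)⁻¹ • tmPhi p k w + (w - e⁻¹)⁻¹ • tmPhi p k w -
        (w - 0)⁻¹ • tmPhi p k w) := by
    rw [levelIntegral, circleIntegral]
    refine intervalIntegral.integral_congr fun θ _ => ?_
    have hw : 1 < ‖circleMap 0 R θ‖ := by rwa [hnorm]
    have hw0 : circleMap 0 R θ ≠ 0 := norm_pos_iff.mp (by linarith)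
    have hd : deriv (levelParam a b R) θ =
        deriv (extPsi a b) (circleMap 0 R θ) * deriv (circleMap 0 R) θ := by
      rw [(hasDerivAt_extPsi a b hw0).deriv, (hasDerivAt_circleMap 0 R θ).deriv]
      exact ((hasDerivAt_extPsi a b hw0).comp θ (hasDerivAt_circleMap 0 R θ)).deriv
    have hinv : extPhi a b (levelParam a b R θ) = circleMap 0 R θ := (extPhi_invOn hab).1 hw
    simp only [hd, hinv, smul_eq_mul, ← add_mul, ← sub_mul, ← deriv_extPsi_div_sub hab hw he]
    simp only [levelParam]
    ring
  rw [faberM, hlevel, circleIntegral.integral_sub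
      (f := fun w => (w - e)⁻¹ • tmPhi p k w + (w - e⁻¹)⁻¹ • tmPhi p k w)
      ((hint e he1).add (hint _ he2)) (hint 0 h0),
    circleIntegral.integral_add (hint e he1) (hint _ he2), hcauchy e he1, hcauchy _ he2,
    hcauchy 0 h0, ← smul_add, ← smul_sub, smul_eq_mul, inv_mul_cancel_left₀]
  exact Complex.two_pi_I_ne_zero

/-- The scalar resolvent expansion. -/
theorem hasSum_tmPhi_mul_faberM {a b R : ℝ} (ha : 0 < a) (hab : a < b) (hR : 1 < R)
    (hRΦ : R < ‖extPhi a b 0‖) {z : ℂ} (hz : z ∉ realSegment a b) {u : ℝ}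
    (hu : u ∈ Set.Icc a b) :
    HasSum (fun k => tmPhi (extPhi a b 0) k (extPhi a b z)⁻¹ * faberM a b R k u)
      (extPhi a b z * deriv (extPsi a b) (extPhi a b z) * (z - u)⁻¹) := by
  obtain ⟨e, he, heu⟩ := exists_norm_eq_one_extPsi_eq hab hu
  have hζ : 1 < ‖extPhi a b z‖ := (extPsi_bijOn hab).surjOn.mapsTo_invFunOn hz
  have hzζ : extPsi a b (extPhi a b z) = z := (extPhi_invOn hab).2 hz
  have hzu := deriv_extPsi_div_sub hab hζ he
  rw [hzζ, heu] at hzu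
  set ζ := extPhi a b z
  have hζ0 : ζ ≠ 0 := norm_pos_iff.mp (by linarith)
  have hv : ‖ζ⁻¹‖ < 1 := by
    rw [norm_inv]
    exact inv_lt_one_of_one_lt₀ hζ
  have hp : 1 < ‖extPhi a b 0‖ := hR.trans hRΦ
  have hreal := conj_extPhi_zero ha hab
  have hsum := ((hasSum_tmPhi_mul_tmPhi hp hreal hv he.le).add
    (hasSum_tmPhi_mul_tmPhi hp hreal hv (w := e⁻¹) (by rw [norm_inv, he, inv_one]))).sub
    (hasSum_tmPhi_mul_tmPhi hp hreal hv (w := 0) (by simp))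
  have hk : ∀ x : ℂ, (1 - ζ⁻¹ * x)⁻¹ = ζ * (ζ - x)⁻¹ := fun x => by
    rw [show 1 - ζ⁻¹ * x = ζ⁻¹ * (ζ - x) by field_simp, mul_inv, inv_inv]
  have hval : ζ * deriv (extPsi a b) ζ * (z - u)⁻¹ =
      (1 - ζ⁻¹ * e)⁻¹ + (1 - ζ⁻¹ * e⁻¹)⁻¹ - (1 - ζ⁻¹ * 0)⁻¹ := by
    rw [hk, hk, hk, mul_assoc, ← div_eq_mul_inv, hzu]
    ring
  rw [hval]
  refine hsum.congr_fun fun k => ?_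
  rw [← heu, faberM_extPsi hab hR hRΦ k he]
  ring

/-- The critical points of Ψ satisfy w² = 1, so they lie on the unit circle and never in the
exterior disk. -/
theorem extPhi_mul_deriv_ne_zero {a b : ℝ} (hab : a < b) {z : ℂ} (hz : z ∉ realSegment a b) :
    extPhi a b z * deriv (extPsi a b) (extPhi a b z) ≠ 0 := by
  have hζ : 1 < ‖extPhi a b z‖ := (extPsi_bijOn hab).surjOn.mapsTo_invFunOn hz
  have hζ0 : extPhi a b z ≠ 0 := norm_pos_iff.mp (by linarith)
  have hr : (((b - a) / 2 : ℝ) : ℂ) ≠ 0 := by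
    exact_mod_cast (by linarith : (0 : ℝ) < (b - a) / 2).ne'
  rw [(hasDerivAt_extPsi a b hζ0).deriv]
  refine mul_ne_zero hζ0 (mul_ne_zero (div_ne_zero hr two_ne_zero) (sub_ne_zero.mpr fun h => ?_))
  have h2 := congrArg norm h
  rw [norm_div, norm_pow, norm_one, eq_div_iff (by positivity), one_mul] at h2
  nlinarith

/-! ### Functional calculus of a real symmetric matrix -/

section MatrixFunction

variable {n : ℕ} {A : Matrix (Fin n) (Fin n) ℝ} (hA : A.IsHermitian)

theorem map_eigenvectorUnitary_mul_conjTranspose :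
    (hA.eigenvectorUnitary : Matrix (Fin n) (Fin n) ℝ).map (fun t : ℝ => (t : ℂ)) *
      ((hA.eigenvectorUnitary : Matrix (Fin n) (Fin n) ℝ).map
        (fun t : ℝ => (t : ℂ))).conjTranspose = 1 := by
  have h : (hA.eigenvectorUnitary : Matrix (Fin n) (Fin n) ℝ) *
      (hA.eigenvectorUnitary : Matrix (Fin n) (Fin n) ℝ).conjTranspose = 1 :=
    Unitary.coe_mul_star_self hA.eigenvectorUnitary
  have h2 := congrArg (fun M => M.map (Complex.ofRealHom : ℝ →+* ℂ)) h
  simp only [Matrix.map_mul] at h2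
  rw [Matrix.map_one _ (map_zero _) (map_one _)] at h2
  rw [← h2]
  congr 1
  ext i j
  simp

theorem symmMatrixFunction_one : symmMatrixFunction hA (fun _ => 1) = 1 := by
  rw [symmMatrixFunction, Matrix.diagonal_one, mul_one,
    map_eigenvectorUnitary_mul_conjTranspose]

theorem symmMatrixFunction_id :
    symmMatrixFunction hA (fun u => u) = A.map (fun t : ℝ => (t : ℂ)) := by
  have h := hA.spectral_theorem
  have h2 := congrArg (fun M => M.map (Complex.ofRealHom : ℝ →+* ℂ)) h
  rw [Unitary.conjStarAlgAut_apply] at h2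
  simp only [Matrix.map_mul] at h2
  rw [symmMatrixFunction]
  refine Eq.trans ?_ h2.symm
  congr 2
  · ext i j
    by_cases hij : i = j <;> simp [hij]
  · ext i j
    simp

theorem symmMatrixFunction_mul (f g : ℂ → ℂ) :
    symmMatrixFunction hA f * symmMatrixFunction hA g =
      symmMatrixFunction hA (fun u => f u * g u) := by
  have h := mul_eq_one_comm.mp (map_eigenvectorUnitary_mul_conjTranspose hA)
  simp only [symmMatrixFunction]
  set U := (hA.eigenvectorUnitary : Matrix (Fin n) (Fin n) ℝ).map (fun t : ℝ => (t : ℂ))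
  rw [← Matrix.diagonal_mul_diagonal]
  simp only [mul_assoc]
  rw [← mul_assoc U.conjTranspose U, h, one_mul]

theorem symmMatrixFunction_sub (f g : ℂ → ℂ) :
    symmMatrixFunction hA (fun u => f u - g u) =
      symmMatrixFunction hA f - symmMatrixFunction hA g := by
  simp only [symmMatrixFunction, ← Matrix.diagonal_sub, mul_sub, sub_mul]

theorem symmMatrixFunction_const_mul (c : ℂ) (f : ℂ → ℂ) :
    symmMatrixFunction hA (fun u => c * f u) = c • symmMatrixFunction hA f := by
  have h : Matrix.diagonal (fun i => c * f (hA.eigenvalues i : ℂ)) =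
      c • Matrix.diagonal (fun i => f (hA.eigenvalues i : ℂ)) := by
    rw [← Matrix.diagonal_smul]
    rfl
  simp only [symmMatrixFunction, h, mul_smul_comm, smul_mul_assoc]

theorem symmMatrixFunction_congr {f g : ℂ → ℂ}
    (h : ∀ i, f (hA.eigenvalues i : ℂ) = g (hA.eigenvalues i : ℂ)) :
    symmMatrixFunction hA f = symmMatrixFunction hA g := by
  simp only [symmMatrixFunction, h]

/-- Conjugation by a fixed matrix is linear and continuous, so convergence at each eigenvalue
suffices. -/
theorem hasSum_symmMatrixFunction {F : ℕ → ℂ → ℂ} {f : ℂ → ℂ}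
    (h : ∀ i, HasSum (fun k => F k (hA.eigenvalues i : ℂ)) (f (hA.eigenvalues i : ℂ))) :
    HasSum (fun k => symmMatrixFunction hA (F k)) (symmMatrixFunction hA f) := by
  have h1 : HasSum (fun k i => F k (hA.eigenvalues i : ℂ)) fun i => f (hA.eigenvalues i : ℂ) :=
    Pi.hasSum.mpr h
  exact (h1.matrix_diagonal.mul_left _).mul_right _

end MatrixFunction

theorem mainTheorem3 {n : ℕ} (A : Matrix (Fin n) (Fin n) ℝ) (hA : A.PosDef) (a b : ℝ)
    (ha : 0 < a) (hab : a < b) (hspec : spectrum ℝ A ⊆ Set.Icc a b)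
    (R : ℝ) (hR : 1 < R) (hRΦ : R < ‖extPhi a b 0‖)
    (z : ℂ) (hz : z ∉ realSegment a b) :
    IsUnit (z • (1 : Matrix (Fin n) (Fin n) ℂ) - A.map (fun t : ℝ => (t : ℂ))) ∧
    extPhi a b z * deriv (extPsi a b) (extPhi a b z) ≠ 0 ∧
    Summable (fun k : ℕ => tmPhi (extPhi a b 0) k (extPhi a b z)⁻¹ •
      symmMatrixFunction hA.isHermitian (faberM a b R k)) ∧
    (z • (1 : Matrix (Fin n) (Fin n) ℂ) - A.map (fun t : ℝ => (t : ℂ)))⁻¹ =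
      (1 / (extPhi a b z * deriv (extPsi a b) (extPhi a b z))) •
        ∑' k : ℕ, tmPhi (extPhi a b 0) k (extPhi a b z)⁻¹ •
          symmMatrixFunction hA.isHermitian (faberM a b R k) := by
  have hH := hA.isHermitian
  have heig : ∀ i, hH.eigenvalues i ∈ Set.Icc a b := fun i =>
    hspec (hH.eigenvalues_mem_spectrum_real i)
  have hne : ∀ i, z - (hH.eigenvalues i : ℂ) ≠ 0 := fun i =>
    sub_ne_zero.mpr fun h => hz ⟨_, heig i, h.symm⟩
  have hD := extPhi_mul_deriv_ne_zero hab hz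
  set D := extPhi a b z * deriv (extPsi a b) (extPhi a b z)
  -- The factor 1 presents z as z times the constant function 1, the shape needed to pull the scalar
  -- out.
  have hres : z • (1 : Matrix (Fin n) (Fin n) ℂ) - A.map (fun t : ℝ => (t : ℂ)) =
      symmMatrixFunction hH (fun u => z * 1 - u) := by
    rw [symmMatrixFunction_sub hH (fun _ => z * 1) (fun u => u), symmMatrixFunction_id,
      symmMatrixFunction_const_mul hH z (fun _ => 1), symmMatrixFunction_one]
  have hmul : (z • (1 : Matrix (Fin n) (Fin n) ℂ) - A.map (fun t : ℝ => (t : ℂ))) *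
      symmMatrixFunction hH (fun u => (z - u)⁻¹) = 1 := by
    rw [hres, symmMatrixFunction_mul, ← symmMatrixFunction_one hH]
    refine symmMatrixFunction_congr hH fun i => ?_
    rw [mul_one, mul_inv_cancel₀ (hne i)]
  have hsum : HasSum (fun k : ℕ => tmPhi (extPhi a b 0) k (extPhi a b z)⁻¹ •
      symmMatrixFunction hH (faberM a b R k))
      (D • symmMatrixFunction hH (fun u => (z - u)⁻¹)) := by
    simp only [← symmMatrixFunction_const_mul]
    exact hasSum_symmMatrixFunction hH fun i =>
      hasSum_tmPhi_mul_faberM ha hab hR hRΦ hz (heig i)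
  -- A one-sided inverse of a square matrix is two-sided. In finite dimension, summability is
  -- absolute convergence.
  refine ⟨IsUnit.of_mul_eq_one _ hmul, hD, hsum.summable, ?_⟩
  rw [hsum.tsum_eq, smul_smul, one_div_mul_cancel hD, one_smul, Matrix.inv_eq_right_inv hmul]
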